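/- Let $\mathbb{K}=\mathbb{R}$ or $\mathbb{K}=\mathbb{C}$, and set $\alpha=1$ if $\mathbb{K}=\mathbb{R}$ and $\alpha=2$ if $\mathbb{K}=\mathbb{C}$. Let $\log$ denote the logarithm to base $2$ and $\ln$ the natural logarithm. Let $p,q\in[1,\infty]$ (with $1/\infty=0$), let $c>0$ and $c_0>0$, let $\psi(t)=ct$ for $t>0$, and consider the $\psi$-exponentially decaying semi-axes $$\mu_n=c_0\exp\{-\ln(2)\,\psi(n)\}=c_0\,2^{-cn},\qquad n\in\mathbb{N}^*=\{1,2,\dots\}.$$ Let $\mathcal{E}_p$ be the ellipsoid $$\mathcal{E}_p=\{x\in\ell^p(\mathbb{N}^*;\mathbb{K}) : \|x\|_{p,\mu}\le 1\},$$ where $\|x\|_{p,\mu}=\bigl(\sum_{n\in\mathbb{N}^*}|x_n/\mu_n|^p\bigr)^{1/p}$ if $p<\infty$ and $\|x\|_{\infty,\mu}=\sup_{n\in\mathbb{N}^*}|x_n/\mu_n|$; it is a subset of $\ell^q(\mathbb{N}^*;\mathbb{K})$. For $\varepsilon>0$, let $N(\varepsilon;\mathcal{E}_p,\|\cdot\|_q)$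 be the least number of closed balls of radius $\varepsilon$ in $\ell^q(\mathbb{N}^*;\mathbb{K})$, with arbitrary centers in that space, that cover $\mathcal{E}_p$, and let $H(\varepsilon;\mathcal{E}_p,\|\cdot\|_q)=\log N(\varepsilon;\mathcal{E}_p,\|\cdot\|_q)$ be the metric entropy. Then, as $\varepsilon\to0^+$, $$H(\varepsilon;\mathcal{E}_p,\|\cdot\|_q)=\frac{\alpha}{2c}\log^2(\varepsilon^{-1})+\frac{\alpha}{c}\Bigl(\frac1q-\frac1p\Bigr)\log(\varepsilon^{-1})\,\log\log(\varepsilon^{-1})+O\bigl(\log(\varepsilon^{-1})\bigr).$$ -/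

import Mathlib

open scoped ENNReal Topology
open Filter Asymptotics

/-- The metric entropy `H(ε; K) = log₂ N(ε; K)` of a set `K` in a metric space `X`, where `N(ε; K)`
is the least number of closed balls of radius `ε`, with centres anywhere in `X`, that cover `K`.
(If no finite covering exists, the value is the junk value `0`.) -/
noncomputable def metricEntropy {X : Type*} [PseudoMetricSpace X] (ε : ℝ) (K : Set X) : ℝ :=
  Real.logb 2 ((Metric.externalCoveringNumber ε.toNNReal K).toNat : ℝ)

/-- The ellipsoid norm `‖x‖_{p,μ}` of a sequence `x`, with values in `[0, ∞]`: the `ℓ^p`-norm of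
the sequence `(x_n / μ_n)`. -/
noncomputable def ellipsoidNorm {𝕜 : Type*} [RCLike 𝕜] (p : ℝ≥0∞) (μ : ℕ+ → ℝ) (x : ℕ+ → 𝕜) :
    ℝ≥0∞ :=
  if p = ∞ then ⨆ n, ‖x n / (μ n : 𝕜)‖ₑ
  else (∑' n, ‖x n / (μ n : 𝕜)‖ₑ ^ p.toReal) ^ (1 / p.toReal)

/-- The infinite-dimensional `p`-ellipsoid `ℰ_p` with semi-axes `μ`: the sequences in `ℓ^p(ℕ*; 𝕜)`
with `‖x‖_{p,μ} ≤ 1`. -/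
def ellipsoid (𝕜 : Type*) [RCLike 𝕜] (p : ℝ≥0∞) (μ : ℕ+ → ℝ) : Set (ℕ+ → 𝕜) :=
  {x | Memℓp x p ∧ ellipsoidNorm p μ x ≤ 1}

/-- The semi-axes `μ` are `ψ`-exponentially decaying: `μ_n = c₀ exp(-ln(2) ψ(n))` for some
`c₀ > 0`. Only the values of `ψ` on `(0, ∞)` matter. -/
def ExponentiallyDecaying (ψ : ℝ → ℝ) (μ : ℕ+ → ℝ) : Prop :=
  ∃ c₀ : ℝ, 0 < c₀ ∧ ∀ n : ℕ+, μ n = c₀ * Real.exp (-(Real.log 2 * ψ (n : ℕ)))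

/-- `H(ε; ℰ_p, ‖·‖_q)`: the metric entropy of the ellipsoid `ℰ_p` as a subset of the space
`ℓ^q(ℕ*; 𝕜)` with its norm. (For the semi-axes considered here every element of `ℰ_p` lies in
`ℓ^q`, see `memℓp_of_mem_ellipsoid`.) -/
noncomputable def ellipsoidEntropy (𝕜 : Type*) [RCLike 𝕜] (p q : ℝ≥0∞) [Fact (1 ≤ q)]
    (μ : ℕ+ → ℝ) (ε : ℝ) : ℝ :=
  metricEntropy ε {x : lp (fun _ : ℕ+ => 𝕜) q | (x : ℕ+ → 𝕜) ∈ ellipsoid 𝕜 p μ}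

/-- Each coordinate of a point of an ellipsoid is bounded by the corresponding semi-axis. -/
theorem norm_le_of_mem_ellipsoid {𝕜 : Type*} [RCLike 𝕜] {p : ℝ≥0∞} (hp : 1 ≤ p) {μ : ℕ+ → ℝ}
    (hμ : ∀ n, 0 < μ n) {x : ℕ+ → 𝕜} (hx : x ∈ ellipsoid 𝕜 p μ) (n : ℕ+) : ‖x n‖ ≤ μ n := by
  have key : ‖x n / (μ n : 𝕜)‖ₑ ≤ 1 := by
    have h := hx.2
    unfold ellipsoidNorm at h
    split_ifs at h with hp'
    · exact (le_iSup (fun n => ‖x n / (μ n : 𝕜)‖ₑ) n).trans h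
    · have h0 : 0 < p.toReal := ENNReal.toReal_pos (by positivity) hp'
      have h1 := (ENNReal.rpow_le_rpow_iff (z := p.toReal) h0).2 h
      rw [← ENNReal.rpow_mul, one_div, inv_mul_cancel₀ h0.ne', ENNReal.rpow_one,
        ENNReal.one_rpow] at h1
      have h2 := (ENNReal.le_tsum (f := fun n => ‖x n / (μ n : 𝕜)‖ₑ ^ p.toReal) n).trans h1
      have h3 : ‖x n / (μ n : 𝕜)‖ₑ ^ p.toReal ≤ 1 ^ p.toReal := by simpa using h2
      exact (ENNReal.rpow_le_rpow_iff h0).1 h3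
  have h1 : ‖x n / (μ n : 𝕜)‖ ≤ 1 := by
    have := ENNReal.toReal_mono ENNReal.one_ne_top key
    simpa [toReal_enorm] using this
  rwa [norm_div, RCLike.norm_ofReal, abs_of_pos (hμ n), div_le_one (hμ n)] at h1

/-- An ellipsoid whose semi-axes decay exponentially at a linear rate lies in every `ℓ^q`. -/
theorem memℓp_of_mem_ellipsoid {𝕜 : Type*} [RCLike 𝕜] {p q : ℝ≥0∞} (hp : 1 ≤ p) (hq : 1 ≤ q)
    {c : ℝ} (hc : 0 < c) {μ : ℕ+ → ℝ} (hμ : ExponentiallyDecaying (fun t => c * t) μ)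
    {x : ℕ+ → 𝕜} (hx : x ∈ ellipsoid 𝕜 p μ) : Memℓp x q := by
  obtain ⟨c₀, hc₀, h⟩ := hμ
  have hpos : ∀ n, 0 < μ n := fun n => by rw [h n]; positivity
  suffices h1 : Memℓp x 1 from h1.of_exponent_ge hq
  apply memℓp_gen
  have hs : Summable (fun n : ℕ => c₀ * Real.exp ((n : ℝ) * (-(Real.log 2 * c)))) := by
    apply Summable.mul_left
    apply Real.summable_exp_nat_mul_iff.2
    have := Real.log_pos one_lt_two
    have := mul_pos this hc
    linarith
  have hs' := hs.comp_injective (i := fun n : ℕ+ => (n : ℕ)) PNat.coe_injective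
  refine Summable.of_nonneg_of_le (fun n => by positivity) (fun n => ?_) hs'
  simp only [ENNReal.toReal_one, Real.rpow_one, Function.comp]
  refine (norm_le_of_mem_ellipsoid hp hpos hx n).trans (le_of_eq ?_)
  rw [h n]
  congr 2
  ring

/-! Write `L = log ε⁻¹` and `θ = 1/q - 1/p`. Only the first `d = L/c + O(1)` coordinates matter, and
on them all `ℓ^r` norms are compared with `ℓ^1` through powers of `d`. Errors of the form `e^{O(d)}`
in the covering number cost only `O(L)` in the entropy, so crude lattice counting replaces volume
computations.

Upper bound (`IsGrid.externalCoveringNumber_ellipsoid_le`): the tail has norm at most `ε/2`, and the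
head is rounded towards zero to a lattice of mesh `δ ≈ ε d^{-1/q}`. By Hölder the rounded points lie
in a weighted `ℓ^1`-ball, whose lattice points number at most `e^d ∏ (C max(1, 4 μ_n d^θ / ε))^α`.

Lower bound (`IsGrid.le_externalCoveringNumber_ellipsoid`): the box with half-sides `d^{-1/p} μ_n`
lies in the ellipsoid and contains at least `∏ (κ μ_n d^θ / ε)^α` lattice points of mesh `ε
d^{-1/q}`, while an `ε`-ball contains only `e^{O(d)}` of them.

Both logarithms are `α ∑ (L + θ log d + O(1) - c n)` up to `O(d)`, with positive parts in the upper
bound. Since `log d = log L + O(1)`, the sum is `(L + θ log L)² / (2c) + O(L)`, which gives both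
main terms. -/

/-! ### Comparison of `ℓ^1`, `ℓ^q` and sup norms -/

theorem one_le_toReal_of_ne_top {p : ℝ≥0∞} (hp : 1 ≤ p) (h : p ≠ ∞) : 1 ≤ p.toReal := by
  simpa using ENNReal.toReal_mono h hp

/-- Hölder's inequality for finite sums: the `ℓ^1`-norm is at most `d^{1-1/p}` times the
`ℓ^p`-norm. -/
theorem sum_le_card_rpow_mul {ι : Type*} {s : Finset ι} {f : ι → ℝ} (hf : ∀ i ∈ s, 0 ≤ f i)
    {p a : ℝ} (hp : 1 ≤ p) (ha : 0 ≤ a) (h : ∑ i ∈ s, f i ^ p ≤ a ^ p) :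
    ∑ i ∈ s, f i ≤ (s.card : ℝ) ^ (1 - p⁻¹) * a := by
  have hp0 : 0 < p := by linarith
  rw [← Real.rpow_le_rpow_iff (Finset.sum_nonneg hf) (by positivity) hp0,
    Real.mul_rpow (by positivity) ha, ← Real.rpow_mul (by positivity), sub_mul,
    inv_mul_cancel₀ hp0.ne', one_mul]
  refine (Real.rpow_sum_le_const_mul_sum_rpow_of_nonneg (s := s) hp hf).trans ?_
  gcongr

/-- The `ℓ^p`-norm of `d` numbers of size at most `a` is at most `d^{1/p} a`. -/
theorem sum_rpow_le_card_rpow_mul {ι : Type*} {s : Finset ι} {f : ι → ℝ} (hf : ∀ i, 0 ≤ f i)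
    {p a : ℝ} (hp : 1 ≤ p) (ha : 0 ≤ a) (hs : ∀ i ∉ s, f i = 0) (h : ∀ i, f i ≤ a)
    (t : Finset ι) : ∑ i ∈ t, f i ^ p ≤ ((s.card : ℝ) ^ p⁻¹ * a) ^ p := by
  classical
  have hp0 : 0 < p := by linarith
  rw [Real.mul_rpow (by positivity) ha, ← Real.rpow_mul (by positivity),
    inv_mul_cancel₀ hp0.ne', Real.rpow_one]
  calc ∑ i ∈ t, f i ^ p ≤ ∑ i ∈ t ∪ s, f i ^ p :=
        Finset.sum_le_sum_of_subset_of_nonneg Finset.subset_union_left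
          fun i _ _ => Real.rpow_nonneg (hf i) p
    _ = ∑ i ∈ s, f i ^ p := by
        refine (Finset.sum_subset Finset.subset_union_right fun i _ hi => ?_).symm
        rw [hs i hi, Real.zero_rpow hp0.ne']
    _ ≤ ∑ i ∈ s, a ^ p := Finset.sum_le_sum fun i _ => Real.rpow_le_rpow (hf i) (h i) hp0.le
    _ = s.card * a ^ p := by simp

section lpNorm

variable {ι 𝕜 : Type*} [NormedAddCommGroup 𝕜] {q : ℝ≥0∞}

theorem lp_norm_le_card_rpow_mul (hq : 1 ≤ q) (x : lp (fun _ : ι => 𝕜) q) (s : Finset ι) {a : ℝ}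
    (ha : 0 ≤ a) (hs : ∀ i ∉ s, x i = 0) (h : ∀ i, ‖x i‖ ≤ a) :
    ‖x‖ ≤ (s.card : ℝ) ^ (q⁻¹).toReal * a := by
  rcases eq_or_ne q ∞ with rfl | hq'
  · exact lp.norm_le_of_forall_le (by positivity) fun i => by simpa using h i
  · have h1 := one_le_toReal_of_ne_top hq hq'
    refine lp.norm_le_of_forall_sum_le (by linarith) (by positivity) fun t => ?_
    rw [ENNReal.toReal_inv]
    exact sum_rpow_le_card_rpow_mul (fun i => norm_nonneg _) h1 ha
      (fun i hi => by rw [hs i hi, norm_zero]) h t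

theorem sum_norm_le_card_rpow_mul_lp_norm (hq : 1 ≤ q) (x : lp (fun _ : ι => 𝕜) q)
    (s : Finset ι) : ∑ i ∈ s, ‖x i‖ ≤ (s.card : ℝ) ^ (1 - (q⁻¹).toReal) * ‖x‖ := by
  rcases eq_or_ne q ∞ with rfl | hq'
  · simpa using Finset.sum_le_card_nsmul s _ _ fun i _ => lp.norm_apply_le_norm (by simp) x i
  · have h1 := one_le_toReal_of_ne_top hq hq'
    rw [ENNReal.toReal_inv]
    exact sum_le_card_rpow_mul (fun i _ => norm_nonneg _) h1 (lp.norm_nonneg' x)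
      (lp.sum_rpow_le_norm_rpow (by linarith) x s)

/-- For finite `q`, each term satisfies `‖x i‖ ^ q ≤ ‖x i‖ * a ^ (q - 1)`. This lets the tail be
estimated in `ℓ^1` for every `q` at once. -/
theorem lp_norm_le_of_sum_norm_le (hq : 1 ≤ q) (x : lp (fun _ : ι => 𝕜) q) {a : ℝ}
    (h : ∀ s : Finset ι, ∑ i ∈ s, ‖x i‖ ≤ a) : ‖x‖ ≤ a := by
  have ha : 0 ≤ a := by simpa using h ∅
  have h1 : ∀ i, ‖x i‖ ≤ a := fun i => by simpa using h {i}
  rcases eq_or_ne q ∞ with rfl | hq'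
  · exact lp.norm_le_of_forall_le ha h1
  · have hq1 := one_le_toReal_of_ne_top hq hq'
    have hsplit : ∀ t : ℝ, 0 ≤ t → t ^ q.toReal = t * t ^ (q.toReal - 1) := fun t ht => by
      conv_rhs => rw [← Real.rpow_one t, ← Real.rpow_mul ht, one_mul,
        ← Real.rpow_add_of_nonneg ht zero_le_one (by linarith), add_sub_cancel]
    refine lp.norm_le_of_forall_sum_le (by linarith) ha fun t => ?_
    calc ∑ i ∈ t, ‖x i‖ ^ q.toReal ≤ ∑ i ∈ t, ‖x i‖ * a ^ (q.toReal - 1) := by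
          refine Finset.sum_le_sum fun i _ => ?_
          rw [hsplit _ (norm_nonneg _)]
          exact mul_le_mul_of_nonneg_left
            (Real.rpow_le_rpow (norm_nonneg _) (h1 i) (by linarith)) (norm_nonneg _)
      _ ≤ a * a ^ (q.toReal - 1) := by
          rw [← Finset.sum_mul]
          exact mul_le_mul_of_nonneg_right (h t) (by positivity)
      _ = a ^ q.toReal := (hsplit a ha).symm

end lpNorm

/-! ### The ellipsoid between a box and a weighted `ℓ^1`-ball -/

section Ellipsoid

variable {𝕜 : Type*} [RCLike 𝕜] {p : ℝ≥0∞} {μ : ℕ+ → ℝ}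

theorem ellipsoidNorm_le_one_iff (hp : 1 ≤ p) (hp' : p ≠ ∞) (hμ : ∀ n, 0 < μ n)
    (x : ℕ+ → 𝕜) : ellipsoidNorm p μ x ≤ 1 ↔
      ∀ s : Finset ℕ+, ∑ n ∈ s, (‖x n‖ / μ n) ^ p.toReal ≤ 1 := by
  have h0 : 0 < p.toReal := by linarith [one_le_toReal_of_ne_top hp hp']
  have key : ∀ s : Finset ℕ+, ∑ n ∈ s, ‖x n / (μ n : 𝕜)‖ₑ ^ p.toReal
      = ENNReal.ofReal (∑ n ∈ s, (‖x n‖ / μ n) ^ p.toReal) := fun s => by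
    rw [ENNReal.ofReal_sum_of_nonneg fun n _ =>
      Real.rpow_nonneg (div_nonneg (norm_nonneg _) (hμ n).le) _]
    refine Finset.sum_congr rfl fun n _ => ?_
    rw [← ofReal_norm, norm_div, RCLike.norm_ofReal, abs_of_pos (hμ n),
      ENNReal.ofReal_rpow_of_nonneg (div_nonneg (norm_nonneg _) (hμ n).le) h0.le]
  rw [ellipsoidNorm, if_neg hp', ← ENNReal.rpow_le_rpow_iff (z := p.toReal) h0,
    ← ENNReal.rpow_mul, one_div, inv_mul_cancel₀ h0.ne', ENNReal.rpow_one, ENNReal.one_rpow,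
    ENNReal.tsum_eq_iSup_sum, iSup_le_iff]
  refine forall_congr' fun s => ?_
  rw [key, ENNReal.ofReal_le_one]

/-- Hölder on the coordinates in `s`: it encloses the truncated ellipsoid in a weighted `ℓ^1`-ball,
the shape for which lattice points are counted. -/
theorem sum_norm_div_le_of_mem_ellipsoid (hp : 1 ≤ p) (hμ : ∀ n, 0 < μ n) {x : ℕ+ → 𝕜}
    (hx : x ∈ ellipsoid 𝕜 p μ) (s : Finset ℕ+) :
    ∑ n ∈ s, ‖x n‖ / μ n ≤ (s.card : ℝ) ^ (1 - (p⁻¹).toReal) := by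
  rcases eq_or_ne p ∞ with rfl | hp'
  · simpa using Finset.sum_le_card_nsmul s (fun n => ‖x n‖ / μ n) 1 fun n _ =>
      (div_le_one (hμ n)).2 (norm_le_of_mem_ellipsoid hp hμ hx n)
  · have h1 := one_le_toReal_of_ne_top hp hp'
    rw [ENNReal.toReal_inv]
    simpa using sum_le_card_rpow_mul (s := s) (f := fun n => ‖x n‖ / μ n) (a := 1)
      (fun n _ => div_nonneg (norm_nonneg _) (hμ n).le) h1 zero_le_one
      (by simpa using (ellipsoidNorm_le_one_iff hp hp' hμ x).1 hx.2 s)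

/-- The inscribed box: `d` ratios of size at most `d^{-1/p}` have `ℓ^p`-norm at most `1`. -/
theorem mem_ellipsoid_of_norm_le (hp : 1 ≤ p) (hμ : ∀ n, 0 < μ n) {x : ℕ+ → 𝕜} (s : Finset ℕ+)
    (hs : ∀ n ∉ s, x n = 0) (h : ∀ n ∈ s, ‖x n‖ ≤ (s.card : ℝ) ^ (-(p⁻¹).toReal) * μ n) :
    x ∈ ellipsoid 𝕜 p μ := by
  have h' : ∀ n, ‖x n‖ / μ n ≤ (s.card : ℝ) ^ (-(p⁻¹).toReal) := fun n => by
    rw [div_le_iff₀ (hμ n)]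
    by_cases hn : n ∈ s
    · exact h n hn
    · rw [hs n hn, norm_zero]
      have := hμ n
      positivity
  refine ⟨(memℓp_zero ((Finset.finite_toSet s).subset fun n hn => ?_)).of_exponent_ge zero_le, ?_⟩
  · by_contra hn'
    exact hn (hs n hn')
  rcases eq_or_ne p ∞ with rfl | hp'
  · rw [ellipsoidNorm, if_pos rfl, iSup_le_iff]
    intro n
    rw [← ofReal_norm, norm_div, RCLike.norm_ofReal, abs_of_pos (hμ n), ENNReal.ofReal_le_one]
    simpa using h' n
  · have h1 := one_le_toReal_of_ne_top hp hp'
    rw [ellipsoidNorm_le_one_iff hp hp' hμ]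
    intro t
    refine (sum_rpow_le_card_rpow_mul (s := s)
      (fun n => div_nonneg (norm_nonneg _) (hμ n).le) h1 (by positivity)
      (fun n hn => by rw [hs n hn, norm_zero, zero_div]) h' t).trans ?_
    refine Real.rpow_le_one (by positivity) ?_ (by linarith)
    rw [ENNReal.toReal_inv]
    rcases Nat.eq_zero_or_pos s.card with h0 | h0
    · have : p.toReal ≠ 0 := by linarith
      rw [h0, Nat.cast_zero, Real.zero_rpow (by simpa using this), zero_mul]
      exact zero_le_one
    · rw [← Real.rpow_add (by exact_mod_cast h0), add_neg_cancel, Real.rpow_zero]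

end Ellipsoid

/-! ### Lattices in the scalar field and exponential counting -/

/-- A countable family of points of `𝕜` that is distributed like a lattice of rank `α`. -/
structure IsGrid {𝕜 Λ : Type*} [RCLike 𝕜] (g : Λ → 𝕜) (α : ℕ) (C κ : ℝ) : Prop where
  one_le : 1 ≤ C
  pos : 0 < κ
  -- Rounding goes towards zero, so it preserves upper bounds on weighted `ℓ^1`-norms.
  exists_round : ∀ y : 𝕜, ∃ z, ‖g z‖ ≤ ‖y‖ ∧ ‖y - g z‖ ≤ 2
  -- About `s^{-α}` lattice points lie within `1/s` of `y` when `s` is small; the `1` in the maximum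
  -- covers the nearest points when `s` is large.
  sum_exp_le : ∀ (s : ℝ) (_ : 0 < s) (y : 𝕜) (T : Finset Λ),
    ∑ z ∈ T, Real.exp (-(s * ‖g z - y‖)) ≤ (C * max 1 s⁻¹) ^ α
  exists_finset : ∀ t : ℝ, 0 ≤ t → ∃ S : Finset Λ, (∀ z ∈ S, ‖g z‖ ≤ t) ∧ (κ * t) ^ α ≤ S.card

theorem sum_pow_natAbs_le {r : ℝ} (h0 : 0 ≤ r) (h1 : r < 1) (T : Finset ℤ) :
    ∑ k ∈ T, r ^ k.natAbs ≤ 2 * (1 - r)⁻¹ := by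
  have key : ∀ U : Finset ℤ, Set.InjOn Int.natAbs (U : Set ℤ) →
      ∑ k ∈ U, r ^ k.natAbs ≤ (1 - r)⁻¹ := fun U hU => by
    rw [← Finset.sum_image (f := fun n : ℕ => r ^ n) hU, ← tsum_geometric_of_lt_one h0 h1]
    exact (summable_geometric_of_lt_one h0 h1).sum_le_tsum _ fun n _ => by positivity
  rw [← Finset.sum_filter_add_sum_filter_not T (fun k => 0 ≤ k), two_mul]
  refine add_le_add (key _ ?_) (key _ ?_) <;>
  · intro a ha b hb hab
    simp only [Finset.coe_filter, Set.mem_ofPred_eq] at ha hb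
    omega

/-- The sum is dominated by a two-sided geometric series of ratio `e^{-u}`, `u = min s 1`, centred
at `⌊y⌋`. Moving the centre costs a factor `e^u ≤ 3`, and `e^{-u} ≤ 1 - u/2` bounds the series by `2
* (2/u)`, whence `12`. -/
theorem sum_exp_neg_abs_sub_le {s : ℝ} (hs : 0 < s) (y : ℝ) (T : Finset ℤ) :
    ∑ k ∈ T, Real.exp (-(s * |(k : ℝ) - y|)) ≤ 12 * max 1 s⁻¹ := by
  set u := min s 1 with hu
  have hu0 : 0 < u := lt_min hs one_pos
  have hu1 : u ≤ 1 := min_le_right _ _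
  have hinv : u⁻¹ ≤ max 1 s⁻¹ := by
    rcases le_total s 1 with h | h
    · rw [hu, min_eq_left h]; exact le_max_right _ _
    · rw [hu, min_eq_right h, inv_one]; exact le_max_left _ _
  have hr : Real.exp (-u) ≤ 1 - u / 2 := by
    rw [Real.exp_neg, inv_le_iff_one_le_mul₀ (Real.exp_pos _)]
    nlinarith [Real.add_one_le_exp u]
  have hterm : ∀ k : ℤ, Real.exp (-(s * |(k : ℝ) - y|))
      ≤ Real.exp 1 * Real.exp (-u) ^ (k - ⌊y⌋).natAbs := fun k => by
    rw [← Real.exp_nat_mul, ← Real.exp_add, Real.exp_le_exp]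
    have e1 : (((k - ⌊y⌋).natAbs : ℕ) : ℝ) = |(k : ℝ) - ⌊y⌋| := by
      rw [Nat.cast_natAbs]; push_cast; rfl
    have e2 : |(k : ℝ) - ⌊y⌋| ≤ |(k : ℝ) - y| + 1 := by
      refine (abs_sub_le (k : ℝ) y ⌊y⌋).trans ?_
      have := Int.floor_le y
      have := Int.lt_floor_add_one y
      gcongr
      rw [abs_le]; constructor <;> linarith
    rw [e1]
    have e3 : u * |(k : ℝ) - y| ≤ s * |(k : ℝ) - y| := by gcongr; exact min_le_left _ _
    nlinarith [mul_le_mul_of_nonneg_left e2 hu0.le]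
  calc ∑ k ∈ T, Real.exp (-(s * |(k : ℝ) - y|))
      ≤ ∑ k ∈ T, Real.exp 1 * Real.exp (-u) ^ (k - ⌊y⌋).natAbs :=
        Finset.sum_le_sum fun k _ => hterm k
    _ = Real.exp 1 * ∑ k ∈ T.image (fun k => k - ⌊y⌋), Real.exp (-u) ^ k.natAbs := by
        rw [← Finset.mul_sum, Finset.sum_image fun a _ b _ h => by simpa using h]
    _ ≤ 3 * (2 * (1 - Real.exp (-u))⁻¹) := by
        refine mul_le_mul (by linarith [Real.exp_one_lt_d9]) ?_
          (Finset.sum_nonneg fun k _ => by positivity) (by norm_num)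
        exact sum_pow_natAbs_le (Real.exp_pos _).le (by linarith) _
    _ ≤ 3 * (2 * (2 * u⁻¹)) := by
        gcongr
        rw [inv_le_comm₀ (by linarith) (by positivity), mul_inv, inv_inv]
        linarith
    _ ≤ 12 * max 1 s⁻¹ := by linarith

theorem exists_int_round (y : ℝ) : ∃ z : ℤ, |(z : ℝ)| ≤ |y| ∧ |y - z| ≤ 1 := by
  rcases le_total 0 y with h | h
  · refine ⟨⌊y⌋, ?_, ?_⟩
    · rw [abs_of_nonneg h, abs_of_nonneg (by exact_mod_cast Int.floor_nonneg.2 h)]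
      exact Int.floor_le y
    · rw [abs_le]; constructor <;> linarith [Int.floor_le y, Int.lt_floor_add_one y]
  · refine ⟨⌈y⌉, ?_, ?_⟩
    · have h1 : ((⌈y⌉ : ℤ) : ℝ) ≤ 0 := by exact_mod_cast Int.ceil_le.2 (by simpa using h)
      rw [abs_of_nonpos h, abs_of_nonpos h1]
      linarith [Int.le_ceil y]
    · rw [abs_le]; constructor <;> linarith [Int.le_ceil y, Int.ceil_lt_add_one y]

theorem exists_finset_int {t : ℝ} (ht : 0 ≤ t) :
    ∃ S : Finset ℤ, (∀ z ∈ S, |(z : ℝ)| ≤ t) ∧ t ≤ S.card := by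
  refine ⟨Finset.Icc (-⌊t⌋) ⌊t⌋, fun z hz => ?_, ?_⟩
  · rw [Finset.mem_Icc, ← abs_le] at hz
    have : ((|z| : ℤ) : ℝ) ≤ ⌊t⌋ := by exact_mod_cast hz
    push_cast at this
    exact this.trans (Int.floor_le t)
  · have h0 : 0 ≤ ⌊t⌋ := Int.floor_nonneg.2 ht
    have h1 : ((Finset.Icc (-⌊t⌋) ⌊t⌋).card : ℤ) = 2 * ⌊t⌋ + 1 := by
      rw [Int.card_Icc, Int.toNat_of_nonneg (by omega)]; ring
    have h2 : ((Finset.Icc (-⌊t⌋) ⌊t⌋).card : ℝ) = 2 * ⌊t⌋ + 1 := by exact_mod_cast h1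
    have h3 : (0 : ℝ) ≤ ⌊t⌋ := by exact_mod_cast h0
    rw [h2]
    linarith [Int.lt_floor_add_one t]

theorem isGrid_int : IsGrid (fun k : ℤ => (k : ℝ)) 1 12 1 where
  one_le := by norm_num
  pos := one_pos
  exists_round y := by
    obtain ⟨z, h1, h2⟩ := exists_int_round y
    exact ⟨z, h1, h2.trans one_le_two⟩
  sum_exp_le s hs y T := by simpa using sum_exp_neg_abs_sub_le hs y T
  exists_finset t ht := by
    obtain ⟨S, h1, h2⟩ := exists_finset_int ht
    exact ⟨S, h1, by simpa using h2⟩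

/-- Everything reduces to coordinates. From `‖w‖ ≥ (|re w| + |im w|)/2` the exponential sum splits
into two integer sums with rate `s/2`, which doubles `12` to `24`; a square of half-side `t/2` lies
in the disc of radius `t`, whence `κ = 1/2`. -/
theorem isGrid_gaussian : IsGrid (fun k : ℤ × ℤ => (⟨k.1, k.2⟩ : ℂ)) 2 24 (1 / 2) where
  one_le := by norm_num
  pos := by norm_num
  exists_round y := by
    obtain ⟨a, ha, ha'⟩ := exists_int_round y.re
    obtain ⟨b, hb, hb'⟩ := exists_int_round y.im
    refine ⟨(a, b), ?_, ?_⟩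
    · rw [← sq_le_sq₀ (norm_nonneg _) (norm_nonneg _), Complex.sq_norm, Complex.sq_norm,
        Complex.normSq_apply, Complex.normSq_apply]
      exact add_le_add (by simpa using mul_self_le_mul_self (abs_nonneg _) ha)
        (by simpa using mul_self_le_mul_self (abs_nonneg _) hb)
    · refine (Complex.norm_le_abs_re_add_abs_im _).trans ?_
      simp only [Complex.sub_re, Complex.sub_im]
      linarith
  sum_exp_le s hs y T := by
    classical
    have hs2 : 0 < s / 2 := by positivity
    have h2 : max 1 (s / 2)⁻¹ ≤ 2 * max 1 s⁻¹ := by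
      refine max_le ?_ ?_
      · linarith [le_max_left 1 s⁻¹]
      · rw [inv_div, div_eq_mul_inv]
        linarith [le_max_right 1 s⁻¹]
    have hA := sum_exp_neg_abs_sub_le hs2 y.re (T.image Prod.fst)
    have hB := sum_exp_neg_abs_sub_le hs2 y.im (T.image Prod.snd)
    calc ∑ z ∈ T, Real.exp (-(s * ‖(⟨z.1, z.2⟩ : ℂ) - y‖))
        ≤ ∑ z ∈ T, Real.exp (-(s / 2 * |(z.1 : ℝ) - y.re|))
            * Real.exp (-(s / 2 * |(z.2 : ℝ) - y.im|)) := by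
          refine Finset.sum_le_sum fun z _ => ?_
          rw [← Real.exp_add, Real.exp_le_exp]
          have e1 := Complex.abs_re_le_norm ((⟨z.1, z.2⟩ : ℂ) - y)
          have e2 := Complex.abs_im_le_norm ((⟨z.1, z.2⟩ : ℂ) - y)
          simp only [Complex.sub_re, Complex.sub_im] at e1 e2
          nlinarith
      _ ≤ ∑ z ∈ T.image Prod.fst ×ˢ T.image Prod.snd,
            Real.exp (-(s / 2 * |(z.1 : ℝ) - y.re|))
              * Real.exp (-(s / 2 * |(z.2 : ℝ) - y.im|)) :=
          Finset.sum_le_sum_of_subset_of_nonneg Finset.subset_product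
            fun z _ _ => by positivity
      _ = (∑ a ∈ T.image Prod.fst, Real.exp (-(s / 2 * |(a : ℝ) - y.re|)))
            * ∑ b ∈ T.image Prod.snd, Real.exp (-(s / 2 * |(b : ℝ) - y.im|)) := by
          rw [Finset.sum_product, Finset.sum_mul_sum]
      _ ≤ (24 * max 1 s⁻¹) * (24 * max 1 s⁻¹) :=
          mul_le_mul (by linarith) (by linarith)
            (Finset.sum_nonneg fun _ _ => (Real.exp_pos _).le) (by positivity)
      _ = (24 * max 1 s⁻¹) ^ 2 := by ring
  exists_finset t ht := by
    obtain ⟨S, h1, h2⟩ := exists_finset_int (t := t / 2) (by positivity)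
    refine ⟨S ×ˢ S, fun z hz => ?_, ?_⟩
    · rw [Finset.mem_product] at hz
      refine (Complex.norm_le_abs_re_add_abs_im _).trans ?_
      linarith [h1 _ hz.1, h1 _ hz.2]
    · rw [Finset.card_product, Nat.cast_mul, ← sq]
      gcongr
      linarith

/-- The number of grid points in a weighted `ℓ^1`-ball. -/
theorem IsGrid.card_le {𝕜 Λ : Type*} [RCLike 𝕜] {g : Λ → 𝕜} {α : ℕ} {C κ : ℝ}
    (hg : IsGrid g α C κ) {ι : Type*} [Fintype ι] (w : ι → ℝ) (hw : ∀ i, 0 < w i) (y : ι → 𝕜)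
    (R : ℝ) (Z : Finset (ι → Λ)) (hZ : ∀ z ∈ Z, ∑ i, w i * ‖g (z i) - y i‖ ≤ R) :
    (Z.card : ℝ) ≤ Real.exp R * ∏ i, (C * max 1 (w i)⁻¹) ^ α := by
  classical
  have hsub : Z ⊆ Fintype.piFinset fun i => Z.image fun z => z i := fun z hz =>
    Fintype.mem_piFinset.2 fun i => Finset.mem_image_of_mem (fun z => z i) hz
  calc (Z.card : ℝ) = ∑ z ∈ Z, 1 := by simp
    -- Chernoff's trick: each counted point has exponential weight at least `1`, and the weight
    -- factorizes over coordinates once the sum is enlarged to a product set.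
    _ ≤ ∑ z ∈ Z, Real.exp R * ∏ i, Real.exp (-(w i * ‖g (z i) - y i‖)) := by
        refine Finset.sum_le_sum fun z hz => ?_
        rw [← Real.exp_sum, ← Real.exp_add, Finset.sum_neg_distrib]
        exact Real.one_le_exp (by linarith [hZ z hz])
    _ = Real.exp R * ∑ z ∈ Z, ∏ i, Real.exp (-(w i * ‖g (z i) - y i‖)) := by
        rw [Finset.mul_sum]
    _ ≤ Real.exp R * ∑ z ∈ Fintype.piFinset fun i => Z.image fun z => z i,
          ∏ i, Real.exp (-(w i * ‖g (z i) - y i‖)) := by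
        gcongr
    _ = Real.exp R * ∏ i, ∑ k ∈ Z.image (fun z => z i),
          Real.exp (-(w i * ‖g k - y i‖)) := by
        rw [Finset.prod_univ_sum]
    _ ≤ Real.exp R * ∏ i, (C * max 1 (w i)⁻¹) ^ α := by
        gcongr with i
        exact hg.sum_exp_le _ (hw i) _ _

/-! ### Covering number bounds for the ellipsoid -/

section Cover

variable {𝕜 Λ : Type*} [RCLike 𝕜] {p q : ℝ≥0∞}

/-- The restriction of a sequence to a finite set of indices, as an element of `ℓ^q`. -/
noncomputable def lpOfFinset (q : ℝ≥0∞) (s : Finset ℕ+) (f : ℕ+ → 𝕜) :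
    lp (fun _ : ℕ+ => 𝕜) q :=
  ⟨fun n => if n ∈ s then f n else 0,
    (memℓp_zero ((Finset.finite_toSet s).subset fun n hn => by
      by_contra hn'
      exact hn (if_neg hn'))).of_exponent_ge zero_le⟩

theorem lpOfFinset_apply (s : Finset ℕ+) (f : ℕ+ → 𝕜) (n : ℕ+) :
    lpOfFinset q s f n = if n ∈ s then f n else 0 := rfl

/-- The point of `ℓ^q` whose coordinates in `s` are `δ` times the grid points given by `z`. -/
noncomputable def gridPoint (q : ℝ≥0∞) (g : Λ → 𝕜) (δ : ℝ) (s : Finset ℕ+) (z : s → Λ) :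
    lp (fun _ : ℕ+ => 𝕜) q :=
  lpOfFinset q s fun n => if h : n ∈ s then (δ : 𝕜) * g (z ⟨n, h⟩) else 0

theorem gridPoint_apply (g : Λ → 𝕜) (δ : ℝ) {s : Finset ℕ+} (z : s → Λ) (i : s) :
    gridPoint q g δ s z i = (δ : 𝕜) * g (z i) := by
  simp [gridPoint, lpOfFinset_apply]

theorem gridPoint_apply_of_notMem (g : Λ → 𝕜) (δ : ℝ) {s : Finset ℕ+} (z : s → Λ) {n : ℕ+}
    (h : n ∉ s) : gridPoint q g δ s z n = 0 := by
  simp [gridPoint, lpOfFinset_apply, h]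

theorem norm_sub_ofReal_mul {δ : ℝ} (hδ : 0 < δ) (a b : 𝕜) :
    ‖a - (δ : 𝕜) * b‖ = δ * ‖a / (δ : 𝕜) - b‖ := by
  have h : (δ : 𝕜) ≠ 0 := RCLike.ofReal_ne_zero.2 hδ.ne'
  have h' : ‖(δ : 𝕜)‖ = δ := by rw [RCLike.norm_ofReal, abs_of_pos hδ]
  calc ‖a - (δ : 𝕜) * b‖ = ‖(δ : 𝕜) * (a / (δ : 𝕜) - b)‖ := by rw [mul_sub, mul_div_cancel₀ _ h]
    _ = δ * ‖a / (δ : 𝕜) - b‖ := by rw [norm_mul, h']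

/-- The exponential count applies to finite sets only; a bound uniform over finite subsets also
yields finiteness. -/
theorem Set.finite_and_ncard_le_of_forall_finset {β : Type*} {A : Set β} {B : ℝ}
    (h : ∀ Z : Finset β, (Z : Set β) ⊆ A → (Z.card : ℝ) ≤ B) : A.Finite ∧ (A.ncard : ℝ) ≤ B := by
  have hfin : A.Finite := by
    by_contra hinf
    obtain ⟨Z, hZ, hc⟩ := Set.Infinite.exists_subset_card_eq hinf (⌊B⌋₊ + 1)
    have h1 := h Z hZ
    rw [hc] at h1
    push_cast at h1
    linarith [Nat.lt_floor_add_one B]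
  refine ⟨hfin, ?_⟩
  rw [Set.ncard_eq_toFinset_card A hfin]
  exact h _ (by simp)

theorem rpow_mul_rpow_neg_self {d : ℝ} (hd : 0 < d) (a : ℝ) : d ^ a * d ^ (-a) = 1 := by
  rw [← Real.rpow_add hd, add_neg_cancel, Real.rpow_zero]

variable [Fact (1 ≤ q)] {g : Λ → 𝕜} {α : ℕ} {C κ : ℝ} {μ : ℕ+ → ℝ}

/-- The distance from a point of the ellipsoid to a suitable grid point. -/
theorem norm_sub_gridPoint_le (hp : 1 ≤ p) (hμ : ∀ n, 0 < μ n) {s : Finset ℕ+}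
    (hs : s.Nonempty) {ε : ℝ} (hε : 0 < ε)
    (htail : ∀ t : Finset ℕ+, Disjoint t s → ∑ n ∈ t, μ n ≤ ε / 2)
    {x : lp (fun _ : ℕ+ => 𝕜) q} (hx : (x : ℕ+ → 𝕜) ∈ ellipsoid 𝕜 p μ) (z : s → Λ)
    (hz : ∀ i : s, ‖x i / ((ε * (s.card : ℝ) ^ (-(q⁻¹).toReal) / 4 : ℝ) : 𝕜) - g (z i)‖ ≤ 2) :
    ‖x - gridPoint q g (ε * (s.card : ℝ) ^ (-(q⁻¹).toReal) / 4) s z‖ ≤ ε := by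
  classical
  have hq : 1 ≤ q := Fact.out
  have hd : (0 : ℝ) < s.card := by exact_mod_cast hs.card_pos
  -- An error `2δ` in each of `d` coordinates has `ℓ^q`-norm at most `d^{1/q} * 2δ = ε/2`; the other
  -- half of `ε` pays for the tail.
  set δ : ℝ := ε * (s.card : ℝ) ^ (-(q⁻¹).toReal) / 4 with hδdef
  have hδ : 0 < δ := by positivity
  set u := x - gridPoint q g δ s z with hu
  have hhead : ‖lpOfFinset q s u‖ ≤ (s.card : ℝ) ^ (q⁻¹).toReal * (2 * δ) := by
    refine lp_norm_le_card_rpow_mul hq _ s (by positivity)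
      (fun n hn => by rw [lpOfFinset_apply, if_neg hn]) fun n => ?_
    rw [lpOfFinset_apply]
    split_ifs with hn
    · have e : (u : ℕ+ → 𝕜) n = x n - gridPoint q g δ s z n := rfl
      rw [e, gridPoint_apply g δ z ⟨n, hn⟩, norm_sub_ofReal_mul hδ]
      nlinarith [hz ⟨n, hn⟩]
    · rw [norm_zero]; positivity
  have htl : ‖u - lpOfFinset q s u‖ ≤ ε / 2 := by
    refine lp_norm_le_of_sum_norm_le hq _ fun t => ?_
    have e : ∀ n, (u - lpOfFinset q s u : lp (fun _ : ℕ+ => 𝕜) q) n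
        = if n ∈ s then 0 else x n := fun n => by
      have e1 : (u - lpOfFinset q s u : lp (fun _ : ℕ+ => 𝕜) q) n
        = x n - gridPoint q g δ s z n - lpOfFinset q s u n := rfl
      have e2 : (u : ℕ+ → 𝕜) n = x n - gridPoint q g δ s z n := rfl
      rw [e1, lpOfFinset_apply, e2]
      split_ifs with hn
      · exact sub_self _
      · rw [gridPoint_apply_of_notMem g δ z hn, sub_zero, sub_zero]
    calc ∑ n ∈ t, ‖(u - lpOfFinset q s u : lp (fun _ : ℕ+ => 𝕜) q) n‖
        ≤ ∑ n ∈ t, if n ∉ s then μ n else 0 := by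
          refine Finset.sum_le_sum fun n _ => ?_
          rw [e]
          split_ifs
          · simp
          · exact norm_le_of_mem_ellipsoid hp hμ hx n
      _ = ∑ n ∈ t.filter (· ∉ s), μ n := (Finset.sum_filter _ _).symm
      _ ≤ ε / 2 := htail _ (Finset.disjoint_left.2 fun n hn => (Finset.mem_filter.1 hn).2)
  calc ‖u‖ = ‖lpOfFinset q s u + (u - lpOfFinset q s u)‖ := by rw [add_sub_cancel]
    _ ≤ (s.card : ℝ) ^ (q⁻¹).toReal * (2 * δ) + ε / 2 :=
        (norm_add_le _ _).trans (add_le_add hhead htl)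
    _ = (s.card : ℝ) ^ (q⁻¹).toReal * (s.card : ℝ) ^ (-(q⁻¹).toReal) * (ε / 2) + ε / 2 := by
        rw [hδdef]; ring
    _ = ε := by rw [rpow_mul_rpow_neg_self hd]; ring

/-- The centres are all lattice points in the weighted `ℓ^1`-ball enclosing the truncated ellipsoid,
so `IsGrid.card_le` bounds their number. -/
theorem IsGrid.externalCoveringNumber_ellipsoid_le (hg : IsGrid g α C κ) (hp : 1 ≤ p)
    (hμ : ∀ n, 0 < μ n) {s : Finset ℕ+} (hs : s.Nonempty) {ε : ℝ} (hε : 0 < ε)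
    (htail : ∀ t : Finset ℕ+, Disjoint t s → ∑ n ∈ t, μ n ≤ ε / 2) :
    Metric.externalCoveringNumber ε.toNNReal
      {x : lp (fun _ : ℕ+ => 𝕜) q | (x : ℕ+ → 𝕜) ∈ ellipsoid 𝕜 p μ} ≠ ⊤ ∧
    ((Metric.externalCoveringNumber ε.toNNReal
      {x : lp (fun _ : ℕ+ => 𝕜) q | (x : ℕ+ → 𝕜) ∈ ellipsoid 𝕜 p μ}).toNat : ℝ) ≤
      Real.exp s.card * ∏ n ∈ s, (C * max 1
        (4 * μ n * (s.card : ℝ) ^ ((q⁻¹).toReal - (p⁻¹).toReal) / ε)) ^ α := by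
  classical
  set E := {x : lp (fun _ : ℕ+ => 𝕜) q | (x : ℕ+ → 𝕜) ∈ ellipsoid 𝕜 p μ} with hE
  set B := Real.exp s.card * ∏ n ∈ s, (C * max 1
        (4 * μ n * (s.card : ℝ) ^ ((q⁻¹).toReal - (p⁻¹).toReal) / ε)) ^ α with hB
  have hd : (0 : ℝ) < s.card := by exact_mod_cast hs.card_pos
  set δ : ℝ := ε * (s.card : ℝ) ^ (-(q⁻¹).toReal) / 4 with hδdef
  have hδ : 0 < δ := by positivity
  -- Normalized so that Hölder's radius `d^{1-1/p}` becomes `d`: the Chernoff factor is then only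
  -- `e^d`, and `1 / w i` is the quantity in the bound.
  set w : s → ℝ := fun i => (s.card : ℝ) ^ (p⁻¹).toReal * δ / μ i with hw
  set A : Set (s → Λ) := {z | ∑ i, w i * ‖g (z i)‖ ≤ s.card} with hA
  obtain ⟨hfin, hcard⟩ : A.Finite ∧ (A.ncard : ℝ) ≤ B := by
    refine Set.finite_and_ncard_le_of_forall_finset fun Z hZ => ?_
    have h1 := hg.card_le w (fun i => by have := hμ i; positivity) (fun _ => 0) s.card Z
      fun z hz => by simp only [sub_zero]; exact hZ hz
    refine h1.trans (le_of_eq ?_)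
    rw [hB, ← Finset.prod_coe_sort s fun n => (C * max 1
      (4 * μ n * (s.card : ℝ) ^ ((q⁻¹).toReal - (p⁻¹).toReal) / ε)) ^ α]
    congr 1
    refine Finset.prod_congr rfl fun i _ => ?_
    congr 3
    rw [hw, hδdef, sub_eq_add_neg, Real.rpow_add hd, Real.rpow_neg hd.le, Real.rpow_neg hd.le]
    have := hμ i
    field_simp
  have hcover : Metric.IsCover ε.toNNReal E (gridPoint q g δ s '' A) := by
    rw [Metric.isCover_iff_subset_iUnion_closedBall]
    intro x hx
    choose z hz1 hz2 using fun i : s => hg.exists_round (x i / (δ : 𝕜))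
    refine Set.mem_biUnion (Set.mem_image_of_mem (gridPoint q g δ s) (show z ∈ A from ?_)) ?_
    · calc ∑ i, w i * ‖g (z i)‖
          ≤ ∑ i : s, (s.card : ℝ) ^ (p⁻¹).toReal * (‖x i‖ / μ i) := by
            refine Finset.sum_le_sum fun i _ => ?_
            have h := hz1 i
            rw [norm_div, RCLike.norm_ofReal, abs_of_pos hδ, le_div_iff₀ hδ] at h
            have := hμ i
            rw [hw]
            calc (s.card : ℝ) ^ (p⁻¹).toReal * δ / μ i * ‖g (z i)‖
                = (s.card : ℝ) ^ (p⁻¹).toReal * (‖g (z i)‖ * δ / μ i) := by ring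
              _ ≤ _ := by gcongr
        _ = (s.card : ℝ) ^ (p⁻¹).toReal * ∑ n ∈ s, ‖x n‖ / μ n := by
            rw [← Finset.mul_sum, Finset.sum_coe_sort s fun n => ‖x n‖ / μ n]
        _ ≤ (s.card : ℝ) ^ (p⁻¹).toReal * (s.card : ℝ) ^ (1 - (p⁻¹).toReal) := by
            gcongr
            exact sum_norm_div_le_of_mem_ellipsoid hp hμ hx s
        _ = s.card := by rw [← Real.rpow_add hd, add_sub_cancel, Real.rpow_one]
    · rw [Metric.mem_closedBall, dist_eq_norm, Real.coe_toNNReal _ hε.le]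
      exact norm_sub_gridPoint_le hp hμ hs hε htail hx z hz2
  have hle := hcover.externalCoveringNumber_le_encard.trans (Set.encard_image_le _ _)
  rw [← hfin.cast_ncard_eq] at hle
  refine ⟨ne_top_of_le_ne_top (ENat.natCast_ne_top _) hle, le_trans ?_ hcard⟩
  exact_mod_cast ENat.toNat_le_of_le_natCast hle

/-- Pigeonhole: the lattice points in the inscribed box are distributed among the balls of an
optimal cover, and each ball receives at most `e^d C^{αd}` of them. Finiteness is needed because
`toNat` sends `⊤` to `0`. -/
theorem IsGrid.le_externalCoveringNumber_ellipsoid (hg : IsGrid g α C κ) (hp : 1 ≤ p)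
    (hμ : ∀ n, 0 < μ n) {s : Finset ℕ+} (hs : s.Nonempty) {ε : ℝ} (hε : 0 < ε)
    (htop : Metric.externalCoveringNumber ε.toNNReal
      {x : lp (fun _ : ℕ+ => 𝕜) q | (x : ℕ+ → 𝕜) ∈ ellipsoid 𝕜 p μ} ≠ ⊤) :
    ∏ n ∈ s, (κ * (μ n * (s.card : ℝ) ^ ((q⁻¹).toReal - (p⁻¹).toReal) / ε)) ^ α ≤
      (Metric.externalCoveringNumber ε.toNNReal
        {x : lp (fun _ : ℕ+ => 𝕜) q | (x : ℕ+ → 𝕜) ∈ ellipsoid 𝕜 p μ}).toNat *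
      (Real.exp s.card * (C ^ α) ^ s.card) := by
  classical
  have hq : 1 ≤ q := Fact.out
  set E := {x : lp (fun _ : ℕ+ => 𝕜) q | (x : ℕ+ → 𝕜) ∈ ellipsoid 𝕜 p μ} with hE
  set N := Metric.externalCoveringNumber ε.toNNReal E with hN
  have hd : (0 : ℝ) < s.card := by exact_mod_cast hs.card_pos
  -- With this mesh the `ℓ^1`-radius `d^{1-1/q} ε` of an `ε`-ball is exactly `d` mesh units, so the
  -- Chernoff factor is again `e^d`.
  set δ : ℝ := ε * (s.card : ℝ) ^ (-(q⁻¹).toReal) with hδdef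
  have hδ : 0 < δ := by positivity
  obtain ⟨F, hF, hFN⟩ : ∃ F : Finset (lp (fun _ : ℕ+ => 𝕜) q),
      Metric.IsCover ε.toNNReal E (F : Set _) ∧ F.card ≤ N.toNat := by
    -- The infimum is attained: since `N` is finite, a cover with fewer than `N + 1` centres has at
    -- most `N`.
    have hlt : N < N + 1 := ENat.lt_add_one_iff htop |>.2 le_rfl
    conv_lhs at hlt => rw [hN, Metric.externalCoveringNumber]
    simp only [iInf_lt_iff] at hlt
    obtain ⟨D, hD, hDN⟩ := hlt
    have hDN' := (ENat.lt_add_one_iff htop).1 hDN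
    have hfin : D.Finite := Set.encard_ne_top_iff.1 (ne_top_of_le_ne_top htop hDN')
    refine ⟨hfin.toFinset, by simpa using hD, ?_⟩
    rw [hfin.encard_eq_coe_toFinset_card, ← ENat.natCast_toNat htop] at hDN'
    exact_mod_cast hDN'
  choose S hS1 hS2 using fun i : s => hg.exists_finset
    ((s.card : ℝ) ^ (-(p⁻¹).toReal) * μ i / δ) (by have := hμ i; positivity)
  set P := Fintype.piFinset S with hP
  have hmem : ∀ z ∈ P, gridPoint q g δ s z ∈ E := fun z hz => by
    refine mem_ellipsoid_of_norm_le hp hμ s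
      (fun n hn => gridPoint_apply_of_notMem g δ z hn) fun n hn => ?_
    rw [gridPoint_apply g δ z ⟨n, hn⟩, norm_mul, RCLike.norm_ofReal, abs_of_pos hδ]
    have := hS1 ⟨n, hn⟩ _ (Fintype.mem_piFinset.1 hz ⟨n, hn⟩)
    rwa [le_div_iff₀ hδ, mul_comm] at this
  have hfiber : ∀ y ∈ F, ((P.filter fun z => dist (gridPoint q g δ s z) y ≤ ε).card : ℝ)
      ≤ Real.exp s.card * (C ^ α) ^ s.card := fun y _ => by
    have h1 := hg.card_le (fun _ : s => (1 : ℝ)) (fun _ => one_pos)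
      (fun i => y i / (δ : 𝕜)) s.card (P.filter fun z => dist (gridPoint q g δ s z) y ≤ ε)
      fun z hz => by
        have hdist : ‖y - gridPoint q g δ s z‖ ≤ ε := by
          rw [← dist_eq_norm, dist_comm]; exact (Finset.mem_filter.1 hz).2
        have h2 := sum_norm_le_card_rpow_mul_lp_norm hq (y - gridPoint q g δ s z) s
        have h3 : ∑ n ∈ s, ‖(y - gridPoint q g δ s z : lp (fun _ : ℕ+ => 𝕜) q) n‖
            = δ * ∑ i : s, ‖g (z i) - y i / (δ : 𝕜)‖ := by
          rw [← Finset.sum_coe_sort, Finset.mul_sum]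
          refine Finset.sum_congr rfl fun i _ => ?_
          have e : (y - gridPoint q g δ s z : lp (fun _ : ℕ+ => 𝕜) q) i
            = y i - gridPoint q g δ s z i := rfl
          rw [e, gridPoint_apply, norm_sub_ofReal_mul hδ, norm_sub_rev]
        have h4 : (s.card : ℝ) ^ (1 - (q⁻¹).toReal) * ε = δ * s.card := by
          rw [hδdef, sub_eq_add_neg, Real.rpow_add hd, Real.rpow_one]; ring
        simp only [one_mul]
        refine le_of_mul_le_mul_left ?_ hδ
        rw [← h3, ← h4]
        exact h2.trans (by gcongr)
    simpa using h1
  calc ∏ n ∈ s, (κ * (μ n * (s.card : ℝ) ^ ((q⁻¹).toReal - (p⁻¹).toReal) / ε)) ^ α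
      = ∏ i : s, (κ * ((s.card : ℝ) ^ (-(p⁻¹).toReal) * μ i / δ)) ^ α := by
        rw [← Finset.prod_coe_sort]
        refine Finset.prod_congr rfl fun i _ => ?_
        congr 2
        rw [hδdef, sub_eq_add_neg, Real.rpow_add hd, Real.rpow_neg hd.le, Real.rpow_neg hd.le]
        field_simp
    _ ≤ ∏ i : s, ((S i).card : ℝ) := by
        refine Finset.prod_le_prod (fun i _ => ?_) fun i _ => hS2 i
        have := hg.pos
        have := hμ i
        positivity
    _ = P.card := by rw [hP, Fintype.card_piFinset]; push_cast; rfl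
    _ ≤ ∑ y ∈ F, ((P.filter fun z => dist (gridPoint q g δ s z) y ≤ ε).card : ℝ) := by
        have hsub : P ⊆ F.biUnion fun y => P.filter fun z => dist (gridPoint q g δ s z) y ≤ ε := by
          intro z hz
          have h := Metric.isCover_iff_subset_iUnion_closedBall.1 hF (hmem z hz)
          simp only [Set.mem_iUnion, Metric.mem_closedBall, Real.coe_toNNReal _ hε.le] at h
          obtain ⟨y, hy, hzy⟩ := h
          exact Finset.mem_biUnion.2 ⟨y, hy, Finset.mem_filter.2 ⟨hz, hzy⟩⟩
        exact_mod_cast (Finset.card_le_card hsub).trans Finset.card_biUnion_le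
    _ ≤ F.card * (Real.exp s.card * (C ^ α) ^ s.card) := by
        rw [← nsmul_eq_mul]
        exact Finset.sum_le_card_nsmul _ _ _ hfiber
    _ ≤ N.toNat * (Real.exp s.card * (C ^ α) ^ s.card) := by
        have := hg.one_le
        gcongr

end Cover

/-! ### Asymptotics of the logarithmic sums -/

/-- Comparison with the integral of the decreasing function `max 0 (A - c t)` over `[0, d]`, proved
in telescoped form by induction. The bound is uniform in `d`, so superfluous coordinates do no harm
here. -/
theorem sum_max_zero_le {c : ℝ} (hc : 0 < c) (A : ℝ) (d : ℕ) :
    ∑ k ∈ Finset.range d, max 0 (A - c * (k + 1)) ≤ A ^ 2 / (2 * c) := by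
  have key : ∀ d : ℕ, ∑ k ∈ Finset.range d, max 0 (A - c * (k + 1))
      ≤ (max 0 A ^ 2 - max 0 (A - c * d) ^ 2) / (2 * c) := fun d => by
    rw [le_div_iff₀ (by positivity)]
    induction d with
    | zero => simp
    | succ d ih =>
      rw [Finset.sum_range_succ, add_mul]
      push_cast
      have h1 : max 0 (A - c * d) ≥ max 0 (A - c * (d + 1)) := by
        gcongr; linarith
      rcases le_total 0 (A - c * (d + 1)) with h | h
      · rw [max_eq_right h] at h1 ⊢
        have hy : max 0 (A - c * d) = A - c * d := max_eq_right (by linarith)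
        rw [hy] at ih
        nlinarith
      · rw [max_eq_left h] at h1 ⊢
        nlinarith [sq_nonneg (max 0 (A - c * d))]
  refine (key d).trans ?_
  gcongr
  have : max 0 A ^ 2 ≤ A ^ 2 := sq_le_sq.2 (by
    rw [abs_of_nonneg (le_max_left _ _)]
    exact max_le (abs_nonneg _) (le_abs_self _))
  linarith [sq_nonneg (max 0 (A - c * d))]

theorem sum_range_sub_mul (A c : ℝ) (d : ℕ) :
    ∑ k ∈ Finset.range d, (A - c * (k + 1)) = d * A - c * (d * (d + 1)) / 2 := by
  induction d with
  | zero => simp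
  | succ d ih => rw [Finset.sum_range_succ, ih]; push_cast; ring

/-- Makes the `(θ log L)²` term in the expanded square `O(L)`. -/
theorem sq_logb_two_le {x : ℝ} (hx : 1 ≤ x) : Real.logb 2 x ^ 2 ≤ 9 * x := by
  have h2 := Real.log_two_gt_d9
  have h0 : 0 ≤ Real.log x := Real.log_nonneg hx
  have h1 : Real.log x ≤ 2 * √x := by
    have := Real.log_le_sub_one_of_pos (Real.sqrt_pos.2 (by linarith : 0 < x))
    rw [Real.log_sqrt (by linarith)] at this
    linarith
  have h3 : Real.log x ^ 2 ≤ 4 * x := by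
    have := pow_le_pow_left₀ h0 h1 2
    rw [mul_pow, Real.sq_sqrt (by linarith)] at this
    linarith
  rw [Real.logb, div_pow, div_le_iff₀ (by positivity)]
  have h4 : (4 / 9 : ℝ) ≤ Real.log 2 ^ 2 := by nlinarith
  nlinarith

/-- If `d` is within a bounded distance of `L / c`, then `log d = log L + O(1)`. -/
theorem eventually_logb_sub_le {c : ℝ} (hc : 0 < c) (b : ℝ) :
    ∀ᶠ L : ℝ in atTop, ∀ d : ℕ, |(d : ℝ) - L / c| ≤ b →
      1 ≤ L ∧ 0 < d ∧ (d : ℝ) ≤ 2 / c * L ∧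
      |Real.logb 2 d - Real.logb 2 L| ≤ 1 + |Real.logb 2 c| := by
  filter_upwards [eventually_ge_atTop 1, eventually_ge_atTop (2 * c * b)] with L h1 hL d hd
  have hL' : b ≤ L / c / 2 := by
    rw [div_div, le_div_iff₀ (by positivity)]; linarith
  have hLc : 0 < L / c := by positivity
  rw [abs_le] at hd
  have hlo : L / c / 2 ≤ d := by linarith
  have hhi : (d : ℝ) ≤ 2 * (L / c) := by linarith
  have hd0 : (0 : ℝ) < d := by linarith
  refine ⟨h1, by exact_mod_cast hd0, by rw [div_mul_eq_mul_div, mul_div_assoc]; exact hhi, ?_⟩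
  have e1 := Real.logb_le_logb_of_le one_lt_two hd0 hhi
  have e2 := Real.logb_le_logb_of_le one_lt_two (by positivity) hlo
  rw [Real.logb_mul two_ne_zero hLc.ne', Real.logb_self_eq_one one_lt_two,
    Real.logb_div (by positivity) hc.ne'] at e1
  rw [Real.logb_div hLc.ne' two_ne_zero, Real.logb_self_eq_one one_lt_two,
    Real.logb_div (by positivity) hc.ne'] at e2
  rw [abs_le]
  constructor <;> linarith [le_abs_self (Real.logb 2 c), neg_abs_le (Real.logb 2 c)]

/-- Replacing `log d` by `log L` leaves a bounded remainder `f`. In the square of `L + (θ log L +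
f)` the cross term gives `2θ L log L + O(L)`, and `(θ log L + f)² ≤ 2(θ log L)² + 2f²` accounts for
`18 + 2 * K₃ ^ 2`. -/
theorem eventually_upper_le {c θ : ℝ} (hc : 0 < c) (hθ : |θ| ≤ 1) (b a m : ℝ) :
    ∃ K, ∀ᶠ L : ℝ in atTop, ∀ d : ℕ, |(d : ℝ) - L / c| ≤ b →
      d * a + (L + θ * Real.logb 2 d + m) ^ 2 / (2 * c) ≤
        1 / (2 * c) * L ^ 2 + 1 / c * θ * L * Real.logb 2 L + K * L := by
  set K₃ := |m| + (1 + |Real.logb 2 c|) with hK₃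
  refine ⟨2 / c * |a| + (2 * K₃ + 18 + 2 * K₃ ^ 2) / (2 * c), ?_⟩
  filter_upwards [eventually_logb_sub_le hc b] with L hL d hd
  obtain ⟨h1, -, hdL, hlog⟩ := hL d hd
  set ℓ := Real.logb 2 L
  set f := θ * (Real.logb 2 d - ℓ) + m with hf
  have hf' : |f| ≤ K₃ := by
    refine (abs_add_le _ _).trans ?_
    rw [abs_mul]
    nlinarith [abs_nonneg (Real.logb 2 d - ℓ), abs_nonneg θ]
  have hK0 : 0 ≤ K₃ := (abs_nonneg f).trans hf'
  have hℓ : ℓ ^ 2 ≤ 9 * L := sq_logb_two_le h1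
  have hθ2 : θ ^ 2 ≤ 1 := by rwa [sq_le_one_iff_abs_le_one]
  have hf2 : f ^ 2 ≤ K₃ ^ 2 := sq_le_sq' (abs_le.1 hf').1 (abs_le.1 hf').2
  have e : L + θ * Real.logb 2 d + m = L + θ * ℓ + f := by rw [hf]; ring
  have hA : (L + θ * ℓ + f) ^ 2
      ≤ L ^ 2 + 2 * (θ * L * ℓ) + (2 * K₃ + 18 + 2 * K₃ ^ 2) * L := by
    have i1 : L * f ≤ L * K₃ := by gcongr; exact (le_abs_self f).trans hf'
    have i2 : (θ * ℓ) ^ 2 ≤ 9 * L := by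
      rw [mul_pow]; nlinarith [sq_nonneg ℓ]
    have i3 : f ^ 2 ≤ K₃ ^ 2 * L := by nlinarith [sq_nonneg K₃]
    nlinarith [sq_nonneg (θ * ℓ - f)]
  have hda : d * a ≤ 2 / c * |a| * L := by
    calc (d : ℝ) * a ≤ d * |a| := by gcongr; exact le_abs_self a
      _ ≤ (2 / c * L) * |a| := by gcongr
      _ = _ := by ring
  rw [e]
  calc d * a + (L + θ * ℓ + f) ^ 2 / (2 * c)
      ≤ 2 / c * |a| * L
        + (L ^ 2 + 2 * (θ * L * ℓ) + (2 * K₃ + 18 + 2 * K₃ ^ 2) * L) / (2 * c) := by gcongr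
    _ = _ := by field_simp; ring

/-- The quadratic `d L - c d² / 2` peaks at `d = L / c`, so a bounded deviation `η` costs only `c η²
/ 2`; meanwhile `d θ log d` is `(L / c) θ log L` up to `O(L)`. -/
theorem eventually_le_lower {c θ : ℝ} (hc : 0 < c) (hθ : |θ| ≤ 1) (b a m : ℝ) :
    ∃ K, ∀ᶠ L : ℝ in atTop, ∀ d : ℕ, |(d : ℝ) - L / c| ≤ b →
      1 / (2 * c) * L ^ 2 + 1 / c * θ * L * Real.logb 2 L - K * L ≤
        d * (L + θ * Real.logb 2 d + m) - c * (d * (d + 1)) / 2 - d * a := by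
  set K₃ := |m| + (1 + |Real.logb 2 c|) + c / 2 + |a| with hK₃
  refine ⟨c * b ^ 2 / 2 + 10 * |b| + 2 / c * K₃, ?_⟩
  filter_upwards [eventually_logb_sub_le hc b] with L hL d hd
  obtain ⟨h1, -, hdL, hlog⟩ := hL d hd
  set ℓ := Real.logb 2 L
  set f := θ * (Real.logb 2 d - ℓ) + m - c / 2 - a with hf
  have hf' : -K₃ ≤ f := by
    have h2 : |θ * (Real.logb 2 d - ℓ)| ≤ 1 + |Real.logb 2 c| := by
      rw [abs_mul]
      nlinarith [abs_nonneg (Real.logb 2 d - ℓ), abs_nonneg θ]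
    linarith [(abs_le.1 h2).1, neg_abs_le m, le_abs_self a]
  have hK0 : 0 ≤ K₃ := by positivity
  have hℓ : ℓ ^ 2 ≤ 9 * L := sq_logb_two_le h1
  set η := (d : ℝ) - L / c with hη
  have hdη : (d : ℝ) = L / c + η := by rw [hη]; ring
  have hη2 : η ^ 2 ≤ b ^ 2 := sq_le_sq' (abs_le.1 hd).1 (abs_le.1 hd).2
  have hηℓ : -(10 * |b| * L) ≤ η * θ * ℓ := by
    have hℓ' : |ℓ| ≤ 10 * L := by nlinarith [sq_abs ℓ, sq_nonneg (|ℓ| - 1)]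
    have : |η * θ * ℓ| ≤ |b| * 1 * (10 * L) := by
      rw [abs_mul, abs_mul]
      exact mul_le_mul (mul_le_mul (hd.trans (le_abs_self b)) hθ (abs_nonneg _) (abs_nonneg _)) hℓ'
        (abs_nonneg _) (by positivity)
    linarith [(abs_le.1 this).1]
  have hdf : -(2 / c * K₃ * L) ≤ d * f := by
    calc -(2 / c * K₃ * L) = -((2 / c * L) * K₃) := by ring
      _ ≤ -(d * K₃) := by gcongr
      _ = d * -K₃ := by ring
      _ ≤ d * f := by gcongr
  have e : d * (L + θ * Real.logb 2 d + m) - c * (d * (d + 1)) / 2 - d * a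
      = 1 / (2 * c) * L ^ 2 + 1 / c * θ * L * ℓ - c * η ^ 2 / 2 + η * θ * ℓ + d * f := by
    have e1 : d * (L + θ * Real.logb 2 d + m) - c * (d * (d + 1)) / 2 - d * a
      = d * L - c * (d * d) / 2 + d * (θ * ℓ) + d * f := by rw [hf]; ring
    rw [e1]
    generalize (d : ℝ) * f = G
    rw [hdη]
    field_simp
    ring
  rw [e]
  have : c * η ^ 2 / 2 ≤ c * b ^ 2 / 2 * L := by
    calc c * η ^ 2 / 2 ≤ c * b ^ 2 / 2 := by gcongr
      _ ≤ c * b ^ 2 / 2 * L := le_mul_of_one_le_right (by positivity) h1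
  linarith

/-! ### Initial index sets and exponentially decaying semi-axes -/

theorem tendsto_logb_two_inv : Tendsto (fun ε : ℝ => Real.logb 2 ε⁻¹) (𝓝[>] 0) atTop :=
  (Real.tendsto_logb_atTop one_lt_two).comp tendsto_inv_nhdsGT_zero

/-- The first `d` positive integers. -/
def initialPNat (d : ℕ) : Finset ℕ+ := (Finset.range d).map ⟨Nat.succPNat, Nat.succPNat_injective⟩

theorem card_initialPNat (d : ℕ) : (initialPNat d).card = d := by simp [initialPNat]

theorem prod_initialPNat (d : ℕ) (f : ℕ+ → ℝ) :
    ∏ n ∈ initialPNat d, f n = ∏ k ∈ Finset.range d, f k.succPNat := by simp [initialPNat]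

theorem mem_initialPNat {d : ℕ} {n : ℕ+} : n ∈ initialPNat d ↔ (n : ℕ) ≤ d := by
  simp only [initialPNat, Finset.mem_map, Finset.mem_range, Function.Embedding.coeFn_mk]
  constructor
  · rintro ⟨k, hk, rfl⟩
    rw [Nat.succPNat_coe]; omega
  · intro h
    exact ⟨n.natPred, by have := n.natPred_add_one; omega, n.succPNat_natPred⟩

theorem sum_semiaxes_tail_le {c c₀ : ℝ} (hc : 0 < c) (hc₀ : 0 < c₀) {μ : ℕ+ → ℝ}
    (hμ : ∀ n : ℕ+, μ n = c₀ * 2 ^ (-(c * (n : ℕ)))) (d : ℕ) (t : Finset ℕ+)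
    (ht : Disjoint t (initialPNat d)) :
    ∑ n ∈ t, μ n ≤ c₀ * 2 ^ (-(c * d)) * (1 - 2 ^ (-c))⁻¹ := by
  have h0 : (0 : ℝ) ≤ 2 ^ (-c) := by positivity
  have h1 : (2 : ℝ) ^ (-c) < 1 := Real.rpow_lt_one_of_one_lt_of_neg one_lt_two (by linarith)
  have hlt : ∀ n ∈ t, d < (n : ℕ) := fun n hn => by
    have := Finset.disjoint_left.1 ht hn
    rw [mem_initialPNat] at this
    omega
  have hinj : Set.InjOn (fun n : ℕ+ => (n : ℕ) - d) (t : Set ℕ+) := fun a ha b hb hab => by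
    have h2 := hlt a ha
    have h3 := hlt b hb
    apply PNat.eq
    simp only at hab
    omega
  calc ∑ n ∈ t, μ n = ∑ n ∈ t, c₀ * 2 ^ (-(c * d)) * ((2 : ℝ) ^ (-c)) ^ ((n : ℕ) - d) := by
        refine Finset.sum_congr rfl fun n hn => ?_
        rw [hμ, ← Real.rpow_natCast, ← Real.rpow_mul two_pos.le, mul_assoc,
          ← Real.rpow_add two_pos, Nat.cast_sub (hlt n hn).le]
        ring_nf
    _ = c₀ * 2 ^ (-(c * d)) * ∑ k ∈ t.image (fun n : ℕ+ => (n : ℕ) - d), ((2 : ℝ) ^ (-c)) ^ k := by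
        rw [← Finset.mul_sum, Finset.sum_image hinj]
    _ ≤ c₀ * 2 ^ (-(c * d)) * (1 - 2 ^ (-c))⁻¹ := by
        gcongr
        rw [← tsum_geometric_of_lt_one h0 h1]
        exact (summable_geometric_of_lt_one h0 h1).sum_le_tsum _ fun n _ => by positivity

theorem logb_two_max_one {x : ℝ} (hx : 0 < x) :
    Real.logb 2 (max 1 x) = max 0 (Real.logb 2 x) := by
  rcases le_total 1 x with h | h
  · rw [max_eq_right h, max_eq_right (Real.logb_nonneg one_lt_two h)]
  · rw [max_eq_left h, max_eq_left (Real.logb_nonpos one_lt_two hx.le h), Real.logb_one]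

theorem abs_toReal_inv_sub_toReal_inv_le_one {p q : ℝ≥0∞} (hp : 1 ≤ p) (hq : 1 ≤ q) :
    |(q⁻¹).toReal - (p⁻¹).toReal| ≤ 1 := by
  have h : ∀ r : ℝ≥0∞, 1 ≤ r → 0 ≤ (r⁻¹).toReal ∧ (r⁻¹).toReal ≤ 1 := fun r hr =>
    ⟨ENNReal.toReal_nonneg, by
      simpa using ENNReal.toReal_mono ENNReal.one_ne_top (ENNReal.inv_le_one.2 hr)⟩
  rw [abs_le]
  constructor <;> linarith [h p hp, h q hq]

/-! ### Entropy bounds and the asymptotic formula -/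

section Main

variable {𝕜 Λ : Type*} [RCLike 𝕜] {p q : ℝ≥0∞} [Fact (1 ≤ q)] {g : Λ → 𝕜} {α : ℕ} {C κ : ℝ}
  {μ : ℕ+ → ℝ} {c c₀ : ℝ}

theorem logb_semiaxis_mul (hc₀ : 0 < c₀) (hμ : ∀ n : ℕ+, μ n = c₀ * 2 ^ (-(c * (n : ℕ))))
    {a D ε : ℝ} (ha : 0 < a) (hD : 0 < D) (hε : 0 < ε) (θ : ℝ) (k : ℕ) :
    Real.logb 2 (a * (μ k.succPNat * D ^ θ / ε)) =
      Real.logb 2 ε⁻¹ + θ * Real.logb 2 D + Real.logb 2 (a * c₀) - c * (k + 1) := by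
  rw [hμ, Nat.succPNat_coe, Nat.succ_eq_add_one, div_eq_mul_inv,
    Real.logb_mul (by positivity) (by positivity), Real.logb_mul (by positivity) (by positivity),
    Real.logb_mul (by positivity) (by positivity), Real.logb_mul (by positivity) (by positivity),
    Real.logb_mul ha.ne' hc₀.ne', Real.logb_rpow two_pos (by norm_num),
    Real.logb_rpow_eq_mul_logb_of_pos hD]
  push_cast
  ring

/-- Logarithms of the two covering bounds. The dimensions are independent: `d` must make the tail
negligible, whereas `d'` is free; finiteness from the upper bound feeds the lower one. -/
theorem IsGrid.ellipsoidEntropy_bounds (hg : IsGrid g α C κ) (hp : 1 ≤ p) (hc : 0 < c)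
    (hc₀ : 0 < c₀) (hμ : ∀ n : ℕ+, μ n = c₀ * 2 ^ (-(c * (n : ℕ)))) {ε : ℝ} (hε : 0 < ε)
    {d d' : ℕ} (hd : 0 < d) (hd' : 0 < d')
    (htail : c₀ * 2 ^ (-(c * d)) * (1 - 2 ^ (-c))⁻¹ ≤ ε / 2) :
    ellipsoidEntropy 𝕜 p q μ ε ≤ d * Real.logb 2 (Real.exp 1) +
      α * (d * Real.logb 2 C + (Real.logb 2 ε⁻¹ + ((q⁻¹).toReal - (p⁻¹).toReal) * Real.logb 2 d
        + Real.logb 2 (4 * c₀)) ^ 2 / (2 * c)) ∧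
    α * (d' * (Real.logb 2 ε⁻¹ + ((q⁻¹).toReal - (p⁻¹).toReal) * Real.logb 2 d'
        + Real.logb 2 (κ * c₀)) - c * (d' * (d' + 1)) / 2) -
      d' * (Real.logb 2 (Real.exp 1) + α * Real.logb 2 C) ≤ ellipsoidEntropy 𝕜 p q μ ε := by
  have hμ0 : ∀ n, 0 < μ n := fun n => by rw [hμ]; positivity
  have hC := hg.one_le
  have hκ := hg.pos
  have hne : ∀ {d : ℕ}, 0 < d → (initialPNat d).Nonempty := fun h => by
    rw [← Finset.card_pos, card_initialPNat]; exact h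
  have hexp : ∀ x : ℕ, Real.logb 2 (Real.exp x) = x * Real.logb 2 (Real.exp 1) := fun x => by
    rw [← Real.logb_pow, ← Real.exp_nat_mul, mul_one]
  have hdR : (0 : ℝ) < d := by exact_mod_cast hd
  have hdR' : (0 : ℝ) < d' := by exact_mod_cast hd'
  obtain ⟨htop, hup⟩ := hg.externalCoveringNumber_ellipsoid_le (q := q) hp hμ0 (hne hd) hε
    fun t ht => (sum_semiaxes_tail_le hc hc₀ hμ d t ht).trans htail
  have hlow := hg.le_externalCoveringNumber_ellipsoid (q := q) hp hμ0 (hne hd') hε htop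
  rw [ellipsoidEntropy, metricEntropy]
  set N : ℝ := ((Metric.externalCoveringNumber ε.toNNReal
    {x : lp (fun _ : ℕ+ => 𝕜) q | (x : ℕ+ → 𝕜) ∈ ellipsoid 𝕜 p μ}).toNat : ℝ)
  set θ := (q⁻¹).toReal - (p⁻¹).toReal
  rw [card_initialPNat, prod_initialPNat] at hup hlow
  have hfac : ∀ k ∈ Finset.range d', (κ * (μ k.succPNat * (d' : ℝ) ^ θ / ε)) ^ α ≠ 0 :=
    fun k _ => by have := hμ0 k.succPNat; positivity
  have hprod : 0 < ∏ k ∈ Finset.range d', (κ * (μ k.succPNat * (d' : ℝ) ^ θ / ε)) ^ α :=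
    Finset.prod_pos fun k _ => by have := hμ0 k.succPNat; positivity
  -- `N = 0` would make `logb` a default value; the lower bound, whose left side is positive,
  -- excludes it.
  have hN : 0 < N := by
    by_contra h
    have : 0 ≤ Real.exp d' * (C ^ α) ^ d' := by positivity
    nlinarith
  have hfac' : ∀ k ∈ Finset.range d,
      (C * max 1 (4 * μ k.succPNat * (d : ℝ) ^ θ / ε)) ^ α ≠ 0 := fun k _ => by positivity
  constructor
  · refine (Real.logb_le_logb_of_le one_lt_two hN hup).trans ?_
    rw [Real.logb_mul (by positivity) (Finset.prod_ne_zero_iff.2 hfac'), hexp,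
      Real.logb_prod _ _ hfac']
    have hterm : ∀ k ∈ Finset.range d,
        Real.logb 2 ((C * max 1 (4 * μ k.succPNat * (d : ℝ) ^ θ / ε)) ^ α) =
          α * (Real.logb 2 C + max 0 ((Real.logb 2 ε⁻¹ + θ * Real.logb 2 d
            + Real.logb 2 (4 * c₀)) - c * (k + 1))) := fun k _ => by
      have hk := hμ0 k.succPNat
      have e : 4 * μ k.succPNat * (d : ℝ) ^ θ / ε = 4 * (μ k.succPNat * (d : ℝ) ^ θ / ε) := by ring
      rw [Real.logb_pow, Real.logb_mul (by positivity) (by positivity), e,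
        logb_two_max_one (by positivity), logb_semiaxis_mul hc₀ hμ (by norm_num) hdR hε]
    rw [Finset.sum_congr rfl hterm, ← Finset.mul_sum, Finset.sum_add_distrib]
    have := sum_max_zero_le hc (Real.logb 2 ε⁻¹ + θ * Real.logb 2 d + Real.logb 2 (4 * c₀)) d
    simp only [Finset.sum_const, Finset.card_range, nsmul_eq_mul]
    gcongr
  · have h := Real.logb_le_logb_of_le one_lt_two hprod hlow
    rw [Real.logb_mul hN.ne' (by positivity), Real.logb_mul (by positivity) (by positivity),
      hexp, Real.logb_pow, Real.logb_pow, Real.logb_prod _ _ hfac] at h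
    have hterm : ∀ k ∈ Finset.range d',
        Real.logb 2 ((κ * (μ k.succPNat * (d' : ℝ) ^ θ / ε)) ^ α) =
          α * ((Real.logb 2 ε⁻¹ + θ * Real.logb 2 d' + Real.logb 2 (κ * c₀)) - c * (k + 1)) :=
      fun k _ => by rw [Real.logb_pow, logb_semiaxis_mul hc₀ hμ hκ hdR' hε]
    rw [Finset.sum_congr rfl hterm, ← Finset.mul_sum, sum_range_sub_mul] at h
    linarith

theorem IsGrid.ellipsoidEntropy_isBigO (hg : IsGrid g α C κ) (hp : 1 ≤ p) (hc : 0 < c)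
    (hμ : ExponentiallyDecaying (fun t => c * t) μ) :
    (fun ε : ℝ => ellipsoidEntropy 𝕜 p q μ ε
        - (α / (2 * c) * Real.logb 2 ε⁻¹ ^ 2
          + α / c * ((q⁻¹).toReal - (p⁻¹).toReal)
            * Real.logb 2 ε⁻¹ * Real.logb 2 (Real.logb 2 ε⁻¹)))
      =O[𝓝[>] 0] (fun ε : ℝ => Real.logb 2 ε⁻¹) := by
  obtain ⟨c₀, hc₀, hμ⟩ := hμ
  have hμ' : ∀ n : ℕ+, μ n = c₀ * 2 ^ (-(c * (n : ℕ))) := fun n => by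
    rw [hμ, Real.rpow_def_of_pos two_pos, mul_neg]
  have hθ := abs_toReal_inv_sub_toReal_inv_le_one hp (Fact.out : 1 ≤ q)
  set θ := (q⁻¹).toReal - (p⁻¹).toReal
  have hr : (0 : ℝ) < 1 - 2 ^ (-c) := by
    have : (2 : ℝ) ^ (-c) < 1 := Real.rpow_lt_one_of_one_lt_of_neg one_lt_two (by linarith)
    linarith
  -- On taking logarithms the tail condition reads `L + m ≤ c d`; the `+ 1` comes from `ε / 2`.
  set m := Real.logb 2 (c₀ * (1 - 2 ^ (-c))⁻¹) + 1 with hm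
  obtain ⟨K₁, h₁⟩ := eventually_upper_le hc hθ (|m| / c + 1) (Real.logb 2 C)
    (Real.logb 2 (4 * c₀))
  obtain ⟨K₂, h₂⟩ := eventually_le_lower hc hθ 1 (Real.logb 2 C) (Real.logb 2 (κ * c₀))
  set e₁ := Real.logb 2 (Real.exp 1) with he₁
  have he₁0 : 0 ≤ e₁ := Real.logb_nonneg one_lt_two (Real.one_le_exp zero_le_one)
  refine IsBigO.of_bound (α * |K₁| + α * |K₂| + 2 / c * e₁) ?_
  filter_upwards [self_mem_nhdsWithin, tendsto_logb_two_inv.eventually h₁,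
    tendsto_logb_two_inv.eventually h₂,
    tendsto_logb_two_inv.eventually (eventually_logb_sub_le hc (|m| / c + 1)),
    tendsto_logb_two_inv.eventually (eventually_logb_sub_le hc 1),
    tendsto_logb_two_inv.eventually_ge_atTop |m|] with ε hε h₁ h₂ h₃ h₄ hmL
  rw [Set.mem_Ioi] at hε
  set L := Real.logb 2 ε⁻¹ with hL
  have hL0 : 0 ≤ L := (abs_nonneg m).trans hmL
  set d := ⌈(L + m) / c⌉₊ with hd
  -- Within `1` of the maximizer `L / c` of the leading quadratic in the lower bound.
  set d' := ⌊L / c⌋₊ with hd'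
  have hdlo : (L + m) / c ≤ d := Nat.le_ceil _
  have hdb : |(d : ℝ) - L / c| ≤ |m| / c + 1 := by
    have hhi : (d : ℝ) < (L + m) / c + 1 :=
      Nat.ceil_lt_add_one (div_nonneg (by linarith [neg_abs_le m]) hc.le)
    have i1 : m / c ≤ |m| / c := by gcongr; exact le_abs_self m
    have i2 : -(|m| / c) ≤ m / c := by rw [← neg_div]; gcongr; exact neg_abs_le m
    rw [add_div] at hhi hdlo
    rw [abs_le]
    constructor <;> linarith
  have hdb' : |(d' : ℝ) - L / c| ≤ 1 := by
    have := Nat.floor_le (div_nonneg hL0 hc.le)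
    have := Nat.lt_floor_add_one (L / c)
    rw [abs_le]
    constructor <;> linarith
  obtain ⟨-, hd0, hdL, -⟩ := h₃ d hdb
  obtain ⟨-, hd0', hdL', -⟩ := h₄ d' hdb'
  have htail : c₀ * 2 ^ (-(c * d)) * (1 - 2 ^ (-c))⁻¹ ≤ ε / 2 := by
    rw [← Real.logb_le_logb one_lt_two (by positivity) (by positivity), mul_right_comm,
      Real.logb_mul (by positivity) (by positivity), Real.logb_rpow two_pos (by norm_num),
      Real.logb_div hε.ne' two_ne_zero, Real.logb_self_eq_one one_lt_two]
    rw [div_le_iff₀ hc] at hdlo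
    rw [Real.logb_inv] at hL
    linarith
  obtain ⟨hU, hB⟩ := hg.ellipsoidEntropy_bounds (q := q) hp hc hc₀ hμ' hε hd0 hd0' htail
  have j₁ := mul_le_mul_of_nonneg_left (h₁ d hdb) (Nat.cast_nonneg (α := ℝ) α)
  have j₂ := mul_le_mul_of_nonneg_left (h₂ d' hdb') (Nat.cast_nonneg (α := ℝ) α)
  have i₁ : d * e₁ ≤ 2 / c * e₁ * L := by nlinarith
  have i₂ : d' * e₁ ≤ 2 / c * e₁ * L := by nlinarith
  have k₁ : α * K₁ * L ≤ α * |K₁| * L := by gcongr; exact le_abs_self _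
  have k₂ : α * K₂ * L ≤ α * |K₂| * L := by gcongr; exact le_abs_self _
  have k₁' : 0 ≤ α * |K₁| * L := by positivity
  have k₂' : 0 ≤ α * |K₂| * L := by positivity
  have hmain : α / (2 * c) * L ^ 2 + α / c * θ * L * Real.logb 2 L
      = α * (1 / (2 * c) * L ^ 2 + 1 / c * θ * L * Real.logb 2 L) := by ring
  rw [Real.norm_eq_abs, Real.norm_eq_abs, abs_of_nonneg hL0, hmain, abs_le]
  constructor <;> linarith

end Main

theorem mainTheorem4 (p q : ℝ≥0∞) (hp : 1 ≤ p) [Fact (1 ≤ q)] (c : ℝ) (hc : 0 < c)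
    (μ : ℕ+ → ℝ) (hμ : ExponentiallyDecaying (fun t => c * t) μ) :
    ((fun ε : ℝ => ellipsoidEntropy ℝ p q μ ε
        - (1 / (2 * c) * Real.logb 2 ε⁻¹ ^ 2
          + 1 / c * ((q⁻¹).toReal - (p⁻¹).toReal)
            * Real.logb 2 ε⁻¹ * Real.logb 2 (Real.logb 2 ε⁻¹)))
      =O[𝓝[>] 0] (fun ε : ℝ => Real.logb 2 ε⁻¹)) ∧
    ((fun ε : ℝ => ellipsoidEntropy ℂ p q μ ε
        - (2 / (2 * c) * Real.logb 2 ε⁻¹ ^ 2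
          + 2 / c * ((q⁻¹).toReal - (p⁻¹).toReal)
            * Real.logb 2 ε⁻¹ * Real.logb 2 (Real.logb 2 ε⁻¹)))
      =O[𝓝[>] 0] (fun ε : ℝ => Real.logb 2 ε⁻¹)) := by
  exact ⟨by simpa only [Nat.cast_one] using isGrid_int.ellipsoidEntropy_isBigO (q := q) hp hc hμ,
    by simpa only [Nat.cast_ofNat] using
      isGrid_gaussian.ellipsoidEntropy_isBigO (q := q) hp hc hμ⟩
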